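/- Let $(M,g)$ be a smooth Hausdorff Riemannian manifold (finite-dimensional, without boundary) with Levi-Civita connection $\nabla$ and curvature $R$. For $(x,u)\in TM$ and $X\in T_xM$, written $X=X^j\partial_{x^j}$ and $u=u^j\partial_{x^j}$ in local coordinates $(x^j)$ with Christoffel symbols $\Gamma^j_{rs}$ and induced coordinates $(x^j,u^j)$ on $TM$, let $$X^h=X^j\frac{\partial}{\partial x^j}-u^rX^s\Gamma^j_{rs}\frac{\partial}{\partial u^j},\qquad X^v=X^j\frac{\partial}{\partial u^j}$$ be the horizontal and vertical lifts of $X$ to $T_{(x,u)}TM$. Let $G$ be a $g$-natural metric on $TM$, that is, a smooth symmetric $(0,2)$-tensor field on $TM$ for which there are functions $a_1,a_2,a_3,b_1,b_2,b_3:[0,\infty)\to\mathbb R$ such that, for all $x\in M$ and $X,Y,u\in T_xM$, with $r^2=g_x(u,u)$, $$G_{(x,u)}(X^h,Y^h)=(a_1+a_3)(r^2)\,g_x(X,Y)+(b_1+b_3)(r^2)\,g_x(X,u)g_x(Y,u),$$ $$G_{(x,u)}(X^h,Y^v)=G_{(x,u)}(X^v,Y^h)=a_2(r^2)\,g_x(X,Y)+b_2(r^2)\,g_x(X,u)g_x(Y,u),$$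 $$G_{(x,u)}(X^v,Y^v)=a_1(r^2)\,g_x(X,Y)+b_1(r^2)\,g_x(X,u)g_x(Y,u).$$ Put $A=a_1+a_3$ and $B=b_1+b_3$. Suppose that $G$ is non-degenerate at every point of $TM$, that $A$ is differentiable with $A'=0$ on $[0,\infty)$, that $B=0$ on $[0,\infty)$, and that either $a_2=0$ on $[0,\infty)$ or $(M,g)$ is flat ($R=0$). Let $u$ be a smooth vector field on $M$ that is parallel, i.e. $\nabla_Xu=0$ for every tangent vector $X$. Then $u(M)=\{(x,u(x)):x\in M\}$ is a totally geodesic submanifold of $(TM,G)$: $x\mapsto(x,u(x))$ is a smooth embedding, and for every smooth local vector field $Y$ on $TM$ that is tangent to $u(M)$ along $u(M)$ and every vector $\xi$ tangent to $u(M)$, the vector $\widetilde\nabla_\xi Y$ is tangent to $u(M)$, where $\widetilde\nabla$ is the Levi-Civita connection of $G$. -/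

import Mathlib

open Set Filter Topology Manifold
open scoped ContDiff

noncomputable section

namespace GNatural

section Connection

variable {E : Type*} [NormedAddCommGroup E] [NormedSpace ℝ E]
  {H : Type*} [TopologicalSpace H] (I : ModelWithCorners ℝ E H)
  {M : Type*} [TopologicalSpace M] [ChartedSpace H M] [IsManifold I ∞ M]

/-- The vector field `X` on `M` is smooth. -/
def IsSmoothField (X : Π x : M, TangentSpace I x) : Prop :=
  ContMDiff I I.tangent ∞ (fun x ↦ (⟨x, X x⟩ : TangentBundle I M))

/-- The components, in the chart `φ` around `x₀`, of a field `h` of bilinear forms on the tangent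
spaces of `M`: at `y` in the image of `φ` this is the pullback of `h` by `d(φ⁻¹)`
(the map `symmL` below is `d(φ⁻¹)` at `φ p`). -/
def formInChart (h : Π x : M, TangentSpace I x →L[ℝ] TangentSpace I x →L[ℝ] ℝ) (x₀ : M)
    (y : E) : E →L[ℝ] E →L[ℝ] ℝ :=
  let p : M := (extChartAt I x₀).symm y
  let e : E →L[ℝ] TangentSpace I p :=
    (trivializationAt E (TangentSpace I : M → Type _) x₀).symmL ℝ p
  (ContinuousLinearMap.precomp ℝ e).comp ((h p).comp e)

/-- The components `dφ(Y)` of a vector field `Y` in the chart `φ` around `x₀`. -/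
def fieldInChart (Y : Π x : M, TangentSpace I x) (x₀ : M) (y : E) : E :=
  let p : M := (extChartAt I x₀).symm y
  (trivializationAt E (TangentSpace I : M → Type _) x₀ (⟨p, Y p⟩ : TangentBundle I M)).2

/-- The Christoffel symbols `Γ(v, w) = v^i w^j Γ^k_{ij} ∂_k` at `y`, in the chart around `x₀`,
of the (pseudo-)Riemannian metric `h`: the vector determined by
`2 h(Γ(v, w), z) = (∂_v h)(w, z) + (∂_w h)(v, z) - (∂_z h)(v, w)` for all `z`. -/
def christoffel (h : Π x : M, TangentSpace I x →L[ℝ] TangentSpace I x →L[ℝ] ℝ) (x₀ : M)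
    (y : E) (v w : E) : E :=
  let D : E →L[ℝ] E →L[ℝ] E →L[ℝ] ℝ := fderiv ℝ (formInChart I h x₀) y
  (formInChart I h x₀ y).inverse ((1 / 2 : ℝ) • (D v w + D w v - (D.flip v).flip w))

/-- The Levi-Civita covariant derivative `∇_v Y` at `x` of the (pseudo-)Riemannian metric `h`,
computed in the chart around `x` (whose coordinate basis at `x` is the one used to identify
`TangentSpace I x` with `E`): `v^i ∂_i Y^k + Γ^k_{ij} v^i Y^j`. -/
def covDeriv (h : Π x : M, TangentSpace I x →L[ℝ] TangentSpace I x →L[ℝ] ℝ)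
    (Y : Π x : M, TangentSpace I x) (x : M) (v : TangentSpace I x) : TangentSpace I x :=
  (fderiv ℝ (fieldInChart I Y x) (extChartAt I x x) (v : E) +
    christoffel I h x (extChartAt I x x) (v : E) (Y x : E) : E)

/-- A vector field is parallel if it is smooth and `∇_v u = 0` for every tangent vector `v`. -/
def IsParallel (h : Π x : M, TangentSpace I x →L[ℝ] TangentSpace I x →L[ℝ] ℝ)
    (u : Π x : M, TangentSpace I x) : Prop :=
  IsSmoothField I u ∧ ∀ (x : M) (v : TangentSpace I x), covDeriv I h u x v = 0

/-- The curvature `R(X, Y)Z = ∇_X ∇_Y Z - ∇_Y ∇_X Z - ∇_{[X, Y]} Z`. -/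
def curvature (h : Π x : M, TangentSpace I x →L[ℝ] TangentSpace I x →L[ℝ] ℝ)
    (X Y Z : Π x : M, TangentSpace I x) (x : M) : TangentSpace I x :=
  covDeriv I h (fun p ↦ covDeriv I h Z p (Y p)) x (X x)
    - covDeriv I h (fun p ↦ covDeriv I h Z p (X p)) x (Y x)
    - covDeriv I h Z x (VectorField.mlieBracket I X Y x)

/-- The metric `h` is flat: its curvature vanishes identically. -/
def IsFlat (h : Π x : M, TangentSpace I x →L[ℝ] TangentSpace I x →L[ℝ] ℝ) : Prop :=
  ∀ X Y Z : Π x : M, TangentSpace I x,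
    IsSmoothField I X → IsSmoothField I Y → IsSmoothField I Z → ∀ x : M, curvature I h X Y Z x = 0

/-- A smooth symmetric `(0, 2)`-tensor field. -/
structure IsSmoothSymmetricForm
    (h : Π x : M, TangentSpace I x →L[ℝ] TangentSpace I x →L[ℝ] ℝ) : Prop where
  symm : ∀ (x : M) (v w : TangentSpace I x), h x v w = h x w v
  contMDiff : ContMDiff I (I.prod 𝓘(ℝ, E →L[ℝ] E →L[ℝ] ℝ)) ∞
    (fun x ↦ Bundle.TotalSpace.mk' (E →L[ℝ] E →L[ℝ] ℝ)
      (E := fun x : M ↦ TangentSpace I x →L[ℝ] TangentSpace I x →L[ℝ] ℝ) x (h x))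

/-- The bilinear form `h` is non-degenerate at every point. -/
def IsNondegenerate (h : Π x : M, TangentSpace I x →L[ℝ] TangentSpace I x →L[ℝ] ℝ) : Prop :=
  ∀ (x : M) (v : TangentSpace I x), (∀ w : TangentSpace I x, h x v w = 0) → v = 0

variable {E' : Type*} [NormedAddCommGroup E'] [NormedSpace ℝ E']
  {H' : Type*} [TopologicalSpace H'] (I' : ModelWithCorners ℝ E' H')
  {P : Type*} [TopologicalSpace P] [ChartedSpace H' P] [IsManifold I' ∞ P]

/-- The image of `f : M → P` is a totally geodesic submanifold of `(P, h)`: `f` is a smooth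
embedding (a smooth immersion that is a homeomorphism onto its image), and for every smooth
local vector field `Y` on `P` that is tangent to `f(M)` along `f(M)` and every tangent vector
`ξ = df(v)` of `f(M)`, the vector `∇_ξ Y` is again tangent to `f(M)`; here `∇` is the Levi-Civita
connection of `h`. In other words, the second fundamental form of `f(M)` vanishes. -/
structure IsTotallyGeodesic (h : Π z : P, TangentSpace I' z →L[ℝ] TangentSpace I' z →L[ℝ] ℝ)
    (f : M → P) : Prop where
  contMDiff : ContMDiff I I' ∞ f
  injective_mfderiv : ∀ x : M, Function.Injective (mfderiv I I' f x)
  isEmbedding : IsEmbedding f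
  covDeriv_mem : ∀ (Y : Π z : P, TangentSpace I' z) (x : M),
    ContMDiffAt I' I'.tangent ∞ (fun z ↦ (⟨z, Y z⟩ : TangentBundle I' P)) (f x) →
    (∀ᶠ p in 𝓝 x, Y (f p) ∈ Set.range (mfderiv I I' f p)) →
    ∀ v : TangentSpace I x,
      covDeriv I' h Y (f x) (mfderiv I I' f x v) ∈ Set.range (mfderiv I I' f x)

end Connection

section TangentBundle

variable {E : Type*} [NormedAddCommGroup E] [NormedSpace ℝ E]
  {H : Type*} [TopologicalSpace H] (I : ModelWithCorners ℝ E H)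
  {M : Type*} [TopologicalSpace M] [ChartedSpace H M] [IsManifold I ∞ M]

/-- The horizontal lift of `X ∈ T_xM` to `z = (x, u) ∈ TM`, in the coordinates `(x^j, u^j)` on
`TM` induced by the chart around `x`: `X^h = X^j ∂/∂x^j - u^r X^s Γ^j_{rs} ∂/∂u^j`. -/
def horizontalLift (h : Π x : M, TangentSpace I x →L[ℝ] TangentSpace I x →L[ℝ] ℝ)
    (z : TangentBundle I M) (X : TangentSpace I z.proj) : TangentSpace I.tangent z :=
  ((X, - christoffel I h z.proj (extChartAt I z.proj z.proj) (z.snd : E) (X : E)) : E × E)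

/-- The vertical lift `X^v = X^j ∂/∂u^j` of `X ∈ T_xM` to `z = (x, u) ∈ TM`. -/
def verticalLift (z : TangentBundle I M) (X : TangentSpace I z.proj) : TangentSpace I.tangent z :=
  ((0, X) : E × E)

/-- The field of bilinear forms `G` on `TM` is the `g`-natural one given by the functions
`a₁, a₂, a₃, b₁, b₂, b₃` on `[0, ∞)`. -/
structure IsGNatural (g : Bundle.ContMDiffRiemannianMetric I ∞ E (fun x : M ↦ TangentSpace I x))
    (a₁ a₂ a₃ b₁ b₂ b₃ : ℝ → ℝ)
    (G : Π z : TangentBundle I M,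
      TangentSpace I.tangent z →L[ℝ] TangentSpace I.tangent z →L[ℝ] ℝ) : Prop where
  hor_hor : ∀ (x : M) (u X Y : TangentSpace I x),
    G ⟨x, u⟩ (horizontalLift I g.inner ⟨x, u⟩ X) (horizontalLift I g.inner ⟨x, u⟩ Y)
      = (a₁ + a₃) (g.inner x u u) * g.inner x X Y
        + (b₁ + b₃) (g.inner x u u) * g.inner x X u * g.inner x Y u
  hor_ver : ∀ (x : M) (u X Y : TangentSpace I x),
    G ⟨x, u⟩ (horizontalLift I g.inner ⟨x, u⟩ X) (verticalLift I ⟨x, u⟩ Y)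
      = a₂ (g.inner x u u) * g.inner x X Y
        + b₂ (g.inner x u u) * g.inner x X u * g.inner x Y u
  ver_hor : ∀ (x : M) (u X Y : TangentSpace I x),
    G ⟨x, u⟩ (verticalLift I ⟨x, u⟩ X) (horizontalLift I g.inner ⟨x, u⟩ Y)
      = a₂ (g.inner x u u) * g.inner x X Y
        + b₂ (g.inner x u u) * g.inner x X u * g.inner x Y u
  ver_ver : ∀ (x : M) (u X Y : TangentSpace I x),
    G ⟨x, u⟩ (verticalLift I ⟨x, u⟩ X) (verticalLift I ⟨x, u⟩ Y)
      = a₁ (g.inner x u u) * g.inner x X Y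
        + b₁ (g.inner x u u) * g.inner x X u * g.inner x Y u

end TangentBundle

end GNatural

end

/-! Since `u` is parallel, du(X) is the horizontal lift X^h at u(x), so the tangent vectors of u(M)
are exactly the horizontal vectors at its points. It suffices to see that differentiating tangent
fields along u(M) creates no transverse component, and this follows from Koszul's formula for G.

In an induced chart u(M) is the graph of the components of `u`, with tangent fields S_X = (X, Du X).
As A is a constant c and B = 0, G(X^h, Y^h) = c g(X, Y) on all of TM. Along the graph this gives the
tangential part of Koszul's formula, which is c times the one for g. Along a fibre it expresses the
vertical derivative of G on horizontal vectors through products G(X^h, Z^v). Those products are a₂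
g(X, Z) + b₂ g(X, u) g(Z, u), and along the graph a₂ and b₂ are locally constant because |u|² is
(`eventually_norm_parallel_eq`). The identity R(X, Y)u = 0 enters as the symmetry of D²u.

The outcome is Γ^G(S_X, S_Y) = S_{Γ(X,Y)} - (0, D²u(X, Y)) (`koszul_graph`,
`christoffel_tangent_parallel`). The coordinate derivative of a tangent field along the graph is
tangent up to + (0, D²u(X, Y)) (`exists_fderiv_tangent_graph`), so the two second-derivative terms
cancel in the covariant derivative. -/

namespace GNatural

/-! ### Koszul's formula along a graph, in coordinates. -/

section Calculus

variable {D V W E : Type*} [NormedAddCommGroup D] [NormedSpace ℝ D]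
  [NormedAddCommGroup V] [NormedSpace ℝ V] [NormedAddCommGroup W] [NormedSpace ℝ W]
  [NormedAddCommGroup E] [NormedSpace ℝ E]

/-- Leibniz rule for a variable bilinear form evaluated on variable vectors. -/
theorem fderiv_form_apply {F : D → V →L[ℝ] V →L[ℝ] ℝ} {a b : D → V} {y : D}
    (hF : DifferentiableAt ℝ F y) (ha : DifferentiableAt ℝ a y) (hb : DifferentiableAt ℝ b y)
    (X : D) :
    fderiv ℝ (fun y ↦ F y (a y) (b y)) y X =
      fderiv ℝ F y X (a y) (b y) + F y (fderiv ℝ a y X) (b y) + F y (a y) (fderiv ℝ b y X) := by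
  rw [((hF.hasFDerivAt.clm_apply ha.hasFDerivAt).clm_apply hb.hasFDerivAt).fderiv]
  simp
  ring

/-- The derivative of the graph `y ↦ (y, u y)` of a map. -/
theorem fderiv_graph_apply {u : E → W} {y : E} (hu : DifferentiableAt ℝ u y) (X : E) :
    fderiv ℝ (fun y ↦ (y, u y)) y X = (X, fderiv ℝ u y X) := by
  have h : HasFDerivAt (fun y ↦ (y, u y)) ((ContinuousLinearMap.id ℝ E).prod (fderiv ℝ u y)) y :=
    (hasFDerivAt_id y).prodMk hu.hasFDerivAt
  rw [h.fderiv]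
  rfl

/-- Koszul's formula for a metric `F` on `E × E` along the graph of `u`. The hypotheses express,
in coordinates, that `u` is parallel for the metric `f` with Christoffel symbols `Γ`, and give the
values of `F` on horizontal and vertical vectors. -/
theorem koszul_graph {f : E → E →L[ℝ] E →L[ℝ] ℝ} {F : E × E → (E × E) →L[ℝ] (E × E) →L[ℝ] ℝ}
    {u : E → E} {y₀ : E} {Γ : E → E → E} {c α β : ℝ}
    (hf : DifferentiableAt ℝ f y₀) (hF : DifferentiableAt ℝ F (y₀, u y₀))
    (hu : ContDiffAt ℝ ∞ u y₀)
    (hfs : ∀ᶠ y in 𝓝 y₀, ∀ v w, f y v w = f y w v)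
    (hFs : ∀ v w, F (y₀, u y₀) v w = F (y₀, u y₀) w v)
    (hΓ : ∀ v w z, 2 * f y₀ (Γ v w) z =
      fderiv ℝ f y₀ v w z + fderiv ℝ f y₀ w v z - fderiv ℝ f y₀ z v w)
    (hΓs : ∀ v w, Γ v w = Γ w v)
    (hΓl : ∀ v w z (t : ℝ), Γ (v + t • w) z = Γ v z + t • Γ w z)
    (hpar : ∀ X, fderiv ℝ u y₀ X = - Γ (u y₀) X)
    (hhh : ∀ᶠ y in 𝓝 y₀, ∀ X Y,
      F (y, u y) (X, fderiv ℝ u y X) (Y, fderiv ℝ u y Y) = c * f y X Y)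
    (hhv : ∀ᶠ y in 𝓝 y₀, ∀ X Z, F (y, u y) (X, fderiv ℝ u y X) (0, Z) =
      α * f y X Z + β * f y X (u y) * f y Z (u y))
    (hfib : ∀ w X Y, F (y₀, w) (X, - Γ w X) (Y, - Γ w Y) = c * f y₀ X Y)
    (X Y : E) (Z : E × E) :
    2 * F (y₀, u y₀) ((Γ X Y, fderiv ℝ u y₀ (Γ X Y)) - (0, fderiv ℝ (fderiv ℝ u) y₀ X Y)) Z =
      fderiv ℝ F (y₀, u y₀) (X, fderiv ℝ u y₀ X) (Y, fderiv ℝ u y₀ Y) Z +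
      fderiv ℝ F (y₀, u y₀) (Y, fderiv ℝ u y₀ Y) (X, fderiv ℝ u y₀ X) Z -
      fderiv ℝ F (y₀, u y₀) Z (X, fderiv ℝ u y₀ X) (Y, fderiv ℝ u y₀ Y) := by
  have hud : DifferentiableAt ℝ u y₀ := hu.differentiableAt (by simp)
  have hud2 : DifferentiableAt ℝ (fderiv ℝ u) y₀ :=
    (hu.fderiv_right (m := 1) (by norm_cast)).differentiableAt (by simp)
  -- Symmetry of D²u is the coordinate form of R(X, Y)u = 0.
  have hsymm : ∀ X Y, fderiv ℝ (fderiv ℝ u) y₀ X Y = fderiv ℝ (fderiv ℝ u) y₀ Y X :=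
    (hu.isSymmSndFDerivAt (by simpa using ENat.LEInfty.out)).eq
  have hgr : DifferentiableAt ℝ (fun y ↦ (y, u y)) y₀ := differentiableAt_id.prodMk hud
  have hFgr : DifferentiableAt ℝ (fun y ↦ F (y, u y)) y₀ :=
    DifferentiableAt.comp y₀ (g := F) (f := fun y ↦ (y, u y)) hF hgr
  have hFgr' (X : E) : fderiv ℝ (fun y ↦ F (y, u y)) y₀ X =
      fderiv ℝ F (y₀, u y₀) (X, fderiv ℝ u y₀ X) := by
    rw [← fderiv_graph_apply hud]
    exact congrArg (fun L ↦ L X) (fderiv_comp y₀ (g := F) (f := fun y ↦ (y, u y)) hF hgr)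
  have hS (Y : E) : DifferentiableAt ℝ (fun y ↦ (Y, fderiv ℝ u y Y)) y₀ :=
    (differentiableAt_const _).prodMk (hud2.clm_apply (differentiableAt_const _))
  have hS' (X Y : E) : fderiv ℝ (fun y ↦ (Y, fderiv ℝ u y Y)) y₀ X =
      (0, fderiv ℝ (fderiv ℝ u) y₀ X Y) := by
    rw [((hasFDerivAt_const Y y₀).prodMk
      (hud2.hasFDerivAt.clm_apply (hasFDerivAt_const Y y₀))).fderiv]
    simp
  have hfsD : ∀ X v w, fderiv ℝ f y₀ X v w = fderiv ℝ f y₀ X w v := by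
    intro X v w
    have h1 := fderiv_form_apply hf (differentiableAt_const v) (differentiableAt_const w) X
    have h2 := fderiv_form_apply hf (differentiableAt_const w) (differentiableAt_const v) X
    have : (fun y ↦ f y v w) =ᶠ[𝓝 y₀] (fun y ↦ f y w v) := hfs.mono fun y hy ↦ hy v w
    rw [this.fderiv_eq] at h1
    simp at h1 h2
    rw [← h1, h2]
  have hfs₀ := hfs.self_of_nhds
  have hhh₀ := hhh.self_of_nhds
  have hhv₀ := hhv.self_of_nhds
  -- the derivative of the metric is determined by the Christoffel symbols
  have hcompat : ∀ X v w, fderiv ℝ f y₀ X v w = f y₀ (Γ X v) w + f y₀ v (Γ X w) := by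
    intro X v w
    have h1 := hΓ X v w
    have h2 := hΓ X w v
    have h3 := hfsD X v w
    have h4 := hfsD w X v
    have h5 := hfsD v X w
    have h6 := hfs₀ v (Γ X w)
    linarith
  -- derivatives of the coefficients along the graph
  have hDhh : ∀ X Y Z, fderiv ℝ F (y₀, u y₀) (X, fderiv ℝ u y₀ X) (Y, fderiv ℝ u y₀ Y)
        (Z, fderiv ℝ u y₀ Z) + F (y₀, u y₀) (0, fderiv ℝ (fderiv ℝ u) y₀ X Y)
        (Z, fderiv ℝ u y₀ Z) + F (y₀, u y₀) (Y, fderiv ℝ u y₀ Y)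
        (0, fderiv ℝ (fderiv ℝ u) y₀ X Z) = c * fderiv ℝ f y₀ X Y Z := by
    intro X Y Z
    have h := fderiv_form_apply hFgr (hS Y) (hS Z) X
    have e : (fun y ↦ F (y, u y) (Y, fderiv ℝ u y Y) (Z, fderiv ℝ u y Z))
        =ᶠ[𝓝 y₀] fun y ↦ c * f y Y Z := hhh.mono fun y hy ↦ hy Y Z
    have hd : DifferentiableAt ℝ (fun y ↦ f y Y Z) y₀ :=
      (hf.clm_apply (differentiableAt_const _)).clm_apply (differentiableAt_const _)
    have h2 := fderiv_form_apply hf (differentiableAt_const Y) (differentiableAt_const Z) X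
    rw [e.fderiv_eq, fderiv_const_mul hd, hFgr', hS', hS'] at h
    simp at h h2
    rw [← h, h2]
  have hDhv : ∀ X Y Z, fderiv ℝ F (y₀, u y₀) (X, fderiv ℝ u y₀ X) (Y, fderiv ℝ u y₀ Y)
        (0, Z) + F (y₀, u y₀) (0, fderiv ℝ (fderiv ℝ u) y₀ X Y) (0, Z) =
        α * fderiv ℝ f y₀ X Y Z +
        β * (f y₀ (Γ X Y) (u y₀) * f y₀ Z (u y₀) + f y₀ Y (u y₀) * f y₀ (Γ X Z) (u y₀)) := by
    intro X Y Z
    have h := fderiv_form_apply hFgr (hS Y) (differentiableAt_const (0, Z)) X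
    have e : (fun y ↦ F (y, u y) (Y, fderiv ℝ u y Y) (0, Z))
        =ᶠ[𝓝 y₀] fun y ↦ α * f y Y Z + β * f y Y (u y) * f y Z (u y) :=
      hhv.mono fun y hy ↦ hy Y Z
    have hd : DifferentiableAt ℝ (fun y ↦ f y Y Z) y₀ :=
      (hf.clm_apply (differentiableAt_const _)).clm_apply (differentiableAt_const _)
    have hdu (Y : E) : DifferentiableAt ℝ (fun y ↦ f y Y (u y)) y₀ :=
      (hf.clm_apply (differentiableAt_const _)).clm_apply hud
    have h2 := fderiv_form_apply hf (differentiableAt_const Y) (differentiableAt_const Z) X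
    -- Metric compatibility produces f(Y, Γ(X, u)), which cancels the term from Du X = -Γ(u, X).
    have h3 (Y : E) : fderiv ℝ (fun y ↦ f y Y (u y)) y₀ X = f y₀ (Γ X Y) (u y₀) := by
      rw [fderiv_form_apply hf (differentiableAt_const Y) hud X, hpar, hcompat, hΓs (u y₀)]
      simp
    rw [e.fderiv_eq, fderiv_fun_add (hd.const_mul _) (((hdu Y).const_mul _).fun_mul (hdu Z)),
      fderiv_fun_mul ((hdu Y).const_mul _) (hdu Z), fderiv_const_mul hd,
      fderiv_const_mul (hdu Y), hFgr', hS'] at h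
    simp [h3] at h h2
    rw [h2] at h
    linarith
  -- On the fibre line w = u + tZ the product of the horizontal vectors (X, -Γ(w, X)) and (Y, -Γ(w,
  -- Y)) is constant in t, and these vectors are affine in t. Differentiating at t = 0 leaves the
  -- derivative of F balanced against two mixed products.
  have hDv : ∀ X Y Z, fderiv ℝ F (y₀, u y₀) (0, Z) (X, fderiv ℝ u y₀ X) (Y, fderiv ℝ u y₀ Y) =
      F (y₀, u y₀) (X, fderiv ℝ u y₀ X) (0, Γ Z Y) +
      F (y₀, u y₀) (Y, fderiv ℝ u y₀ Y) (0, Γ Z X) := by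
    intro X Y Z
    have hl : HasFDerivAt (fun t : ℝ ↦ (y₀, u y₀ + t • Z))
        ((0 : ℝ →L[ℝ] E).prod (ContinuousLinearMap.toSpanSingleton ℝ Z)) 0 :=
      (hasFDerivAt_const _ _).prodMk
        ((ContinuousLinearMap.toSpanSingleton ℝ Z).hasFDerivAt.const_add (u y₀))
    have hF0 : HasFDerivAt F (fderiv ℝ F (y₀, u y₀)) (y₀, u y₀ + (0 : ℝ) • Z) := by
      simpa using hF.hasFDerivAt
    have hFl := HasFDerivAt.comp (g := F) (0 : ℝ) hF0 hl
    have hH (X : E) : HasFDerivAt (fun t : ℝ ↦ (X, - Γ (u y₀ + t • Z) X))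
        ((0 : ℝ →L[ℝ] E).prod (- ContinuousLinearMap.toSpanSingleton ℝ (Γ Z X))) 0 := by
      refine (hasFDerivAt_const _ _).prodMk ?_
      simp only [hΓl]
      exact ((ContinuousLinearMap.toSpanSingleton ℝ (Γ Z X)).hasFDerivAt.const_add _).neg
    have h := fderiv_form_apply hFl.differentiableAt (hH X).differentiableAt
      (hH Y).differentiableAt 1
    rw [hFl.fderiv, (hH X).fderiv, (hH Y).fderiv] at h
    simp only [Function.comp_def, hfib] at h
    have e (W : E) : ((0, -W) : E × E) = - (0, W) := by simp
    simp [← hpar] at h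
    rw [e, e, map_neg, map_neg] at h
    simp only [neg_apply] at h
    rw [hFs (Y, _)]
    linarith
  obtain ⟨Z, W⟩ := Z
  -- Split the test vector into a part tangent to the graph and a vertical part, and treat Koszul's
  -- formula on each.
  obtain ⟨W', rfl⟩ : ∃ W', W = fderiv ℝ u y₀ Z + W' := ⟨W - fderiv ℝ u y₀ Z, by simp⟩
  have hZ : ((Z, fderiv ℝ u y₀ Z + W') : E × E) = (Z, fderiv ℝ u y₀ Z) + (0, W') := by simp
  rw [hZ]
  simp only [map_add, map_sub, add_apply, sub_apply]
  rw [hDv X Y W']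
  simp only [hhh₀, hhv₀]
  have k1 := hDhh X Y Z
  have k2 := hDhh Y X Z
  have k3 := hDhh Z X Y
  have k4 := hDhv X Y W'
  have k5 := hDhv Y X W'
  have s1 := hsymm X Y
  have s2 := hsymm X Z
  have s3 := hsymm Y Z
  have q1 := hΓ X Y Z
  have q2 := hΓ X Y W'
  have q3 := hcompat W' X Y
  rw [s1] at k1 k4 ⊢
  rw [s2, hFs (Y, _)] at k1
  rw [s3, hFs (X, _)] at k2
  rw [hFs (X, _)] at k3
  rw [hΓs Y X, hΓs Y W'] at k5
  rw [hΓs X W'] at k4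
  rw [hfs₀ (Γ W' X) Y] at q3
  -- The terms `k1`, `k2`, `k3`, `q1` settle the tangential test vector, the others the vertical
  -- one. There `q3` turns the two α-terms of `hDv` into a derivative of f, and its β-terms cancel
  -- against those of `k4` and `k5`.
  linear_combination -k1 - k2 + k3 - k4 - k5 + c * q1 + α * q2 - α * q3
end Calculus

/-! ### Forms, fields, differentials and Christoffel symbols in charts. -/

section Charts

variable {E : Type*} [NormedAddCommGroup E] [NormedSpace ℝ E]
  {H : Type*} [TopologicalSpace H] {I : ModelWithCorners ℝ E H}
  {M : Type*} [TopologicalSpace M] [ChartedSpace H M] [IsManifold I ∞ M]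

/-- The map `d(φ⁻¹)` at `φ p`, for the chart `φ` around `x₀`. -/
noncomputable abbrev frame (I : ModelWithCorners ℝ E H) {M : Type*} [TopologicalSpace M]
    [ChartedSpace H M] [IsManifold I ∞ M] (x₀ p : M) : E →L[ℝ] TangentSpace I p :=
  (trivializationAt E (TangentSpace I : M → Type _) x₀).symmL ℝ p

theorem formInChart_extChartAt (h : Π x : M, TangentSpace I x →L[ℝ] TangentSpace I x →L[ℝ] ℝ)
    {x₀ p : M} (hp : p ∈ (chartAt H x₀).source) (v w : E) :
    formInChart I h x₀ (extChartAt I x₀ p) v w = h p (frame I x₀ p v) (frame I x₀ p w) := by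
  have : (extChartAt I x₀).symm (extChartAt I x₀ p) = p :=
    (extChartAt I x₀).left_inv (by simpa using hp)
  change h ((extChartAt I x₀).symm (extChartAt I x₀ p)) (frame I x₀ _ v) (frame I x₀ _ w) = _
  rw [this]

theorem frame_fieldInChart (Y : Π x : M, TangentSpace I x)
    {x₀ p : M} (hp : p ∈ (chartAt H x₀).source) :
    frame I x₀ p (fieldInChart I Y x₀ (extChartAt I x₀ p)) = Y p := by
  have : (extChartAt I x₀).symm (extChartAt I x₀ p) = p :=
    (extChartAt I x₀).left_inv (by simpa using hp)
  rw [fieldInChart]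
  rw [this]
  have h := (trivializationAt E (TangentSpace I : M → Type _) x₀).symmL_continuousLinearMapAt
    (R := ℝ) (b := p) hp (Y p)
  rwa [Bundle.Trivialization.continuousLinearMapAt_apply_of_mem _ _ hp] at h

theorem frame_injective {x₀ p : M} (hp : p ∈ (chartAt H x₀).source) :
    Function.Injective (frame I x₀ p) :=
  Function.LeftInverse.injective
    (g := (trivializationAt E (TangentSpace I : M → Type _) x₀).continuousLinearMapAt ℝ p)
    fun v ↦ Bundle.Trivialization.continuousLinearMapAt_symmL _ hp v

theorem frame_eq_tangentCoordChange {x₀ p : M} (hp : p ∈ (chartAt H x₀).source) :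
    frame I x₀ p = tangentCoordChange I x₀ p p :=
  TangentBundle.symmL_trivializationAt_eq_core hp

/-- The preferred chart at x is the one identifying `TangentSpace I x` with E, so no coordinate
change is left. -/
theorem frame_self (x : M) (v : E) : frame I x x v = (v : TangentSpace I x) :=
  (congrArg (fun L : E →L[ℝ] E ↦ L v) (frame_eq_tangentCoordChange (mem_chart_source H x))).trans
    (tangentCoordChange_self (mem_extChartAt_source x))

theorem formInChart_self (h : Π x : M, TangentSpace I x →L[ℝ] TangentSpace I x →L[ℝ] ℝ)
    (x : M) (v w : E) :
    formInChart I h x (extChartAt I x x) v w =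
      h x (v : TangentSpace I x) (w : TangentSpace I x) := by
  rw [formInChart_extChartAt h (mem_chart_source H x)]
  have h1 := frame_self (I := I) x v
  have h2 := frame_self (I := I) x w
  rw [h1, h2]

theorem fieldInChart_self (Y : Π x : M, TangentSpace I x) (x : M) :
    fieldInChart I Y x (extChartAt I x x) = Y x := by
  rw [← frame_fieldInChart Y (mem_chart_source H x)]
  exact (frame_self x _).symm

/-- Smoothness of a section of the Hom bundle is smoothness of its coordinates in the
trivializations at x₀, and near the base point these coordinates are `formInChart`. -/
theorem contDiffAt_formInChart [I.Boundaryless]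
    {h : Π x : M, TangentSpace I x →L[ℝ] TangentSpace I x →L[ℝ] ℝ}
    (hh : IsSmoothSymmetricForm I h) (x₀ : M) :
    ContDiffAt ℝ ∞ (formInChart I h x₀) (extChartAt I x₀ x₀) := by
  have h1 := ((contMDiffAt_hom_bundle _).1 (hh.contMDiff x₀)).2
  have h2 := (contMDiffAt_iff_source).1 h1
  rw [I.range_eq_univ] at h2
  refine (contMDiffAt_iff_contDiffAt.1 h2).congr_of_eventuallyEq ?_
  filter_upwards [extChartAt_target_mem_nhds (I := I) x₀] with y hy
  have hp : (extChartAt I x₀).symm y ∈ (chartAt H x₀).source := by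
    simpa using (extChartAt I x₀).map_target hy
  ext v w
  refine Eq.trans ?_ (inCoordinates_apply_eq₂ (F₃ := ℝ) (E₃ := Bundle.Trivial M ℝ)
    (x₀ := x₀) hp hp (mem_univ _)).symm
  simp only [Bundle.Trivial.fiberBundle_trivializationAt',
    Bundle.Trivial.linearMapAt_trivialization, LinearMap.id_apply]
  change h _ (frame I x₀ _ v) (frame I x₀ _ w) = _
  rw [frame, Bundle.Trivialization.symmL_apply _ hp, Bundle.Trivialization.symmL_apply _ hp]

theorem contDiffAt_fieldInChart [I.Boundaryless] {Y : Π x : M, TangentSpace I x} {x₀ : M}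
    (hY : ContMDiffAt I I.tangent ∞ (fun x ↦ (⟨x, Y x⟩ : TangentBundle I M)) x₀) :
    ContDiffAt ℝ ∞ (fieldInChart I Y x₀) (extChartAt I x₀ x₀) := by
  have h1 := (Bundle.contMDiffAt_section x₀).1 hY
  have h2 := (contMDiffAt_iff_source).1 h1
  rw [I.range_eq_univ] at h2
  exact contMDiffAt_iff_contDiffAt.1 h2

variable {E' : Type*} [NormedAddCommGroup E'] [NormedSpace ℝ E']
  {H' : Type*} [TopologicalSpace H'] {I' : ModelWithCorners ℝ E' H'}
  {P : Type*} [TopologicalSpace P] [ChartedSpace H' P] [IsManifold I' ∞ P]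

/-- `mfderiv` is computed in the preferred charts at p and f p. The chain rule, applied to two
factorizations of one coordinate expression, transfers it to fixed charts around x₀ and z₀, which is
needed in order to differentiate in p. -/
theorem mfderiv_frame [I.Boundaryless] [I'.Boundaryless] {f : M → P} {x₀ p : M} {z₀ : P}
    (hf : MDifferentiableAt I I' f p) (hp : p ∈ (chartAt H x₀).source)
    (hfp : f p ∈ (chartAt H' z₀).source) (v : E) :
    mfderiv I I' f p (frame I x₀ p v) =
      frame I' z₀ (f p)
        (fderiv ℝ (extChartAt I' z₀ ∘ f ∘ (extChartAt I x₀).symm) (extChartAt I x₀ p) v) := by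
  have hp' : p ∈ (extChartAt I x₀).source := by simpa using hp
  have hfp' : f p ∈ (extChartAt I' z₀).source := by simpa using hfp
  have hd : DifferentiableAt ℝ (extChartAt I' z₀ ∘ f ∘ (extChartAt I x₀).symm)
      (extChartAt I x₀ p) := by
    have := ((mdifferentiableAt_iff_of_mem_source hp hfp).1 hf).2
    rwa [I.range_eq_univ, differentiableWithinAt_univ] at this
  have hd' : DifferentiableAt ℝ (extChartAt I' (f p) ∘ f ∘ (extChartAt I p).symm)
      (extChartAt I p p) := by
    have := ((mdifferentiableAt_iff_of_mem_source
      (mem_chart_source H p) (mem_chart_source H' (f p))).1 hf).2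
    rwa [I.range_eq_univ, differentiableWithinAt_univ] at this
  have hinv : (extChartAt I x₀).symm (extChartAt I x₀ p) = p := (extChartAt I x₀).left_inv hp'
  have hsrc := hasFDerivWithinAt_tangentCoordChange (I := I) (x := x₀) (y := p) (z := p)
    ⟨hp', mem_extChartAt_source p⟩
  have htgt := hasFDerivWithinAt_tangentCoordChange (I := I') (x := z₀) (y := f p) (z := f p)
    ⟨hfp', mem_extChartAt_source (f p)⟩
  rw [I.range_eq_univ, hasFDerivWithinAt_univ] at hsrc
  rw [I'.range_eq_univ, hasFDerivWithinAt_univ] at htgt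
  have e1 : (extChartAt I' z₀ ∘ f ∘ (extChartAt I x₀).symm) (extChartAt I x₀ p) =
      extChartAt I' z₀ (f p) := by simp only [Function.comp_apply, hinv]
  have e2 : (extChartAt I p ∘ (extChartAt I x₀).symm) (extChartAt I x₀ p) = extChartAt I p p := by
    simp only [Function.comp_apply, hinv]
  rw [← e1] at htgt
  rw [← e2] at hd'
  have k1 := htgt.comp _ hd.hasFDerivAt
  have k2 := hd'.hasFDerivAt.comp _ hsrc
  have hcont : ContinuousAt (extChartAt I x₀).symm (extChartAt I x₀ p) :=
    continuousAt_extChartAt_symm' hp'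
  have hM : ∀ᶠ q in 𝓝 p, q ∈ (extChartAt I p).source ∧ f q ∈ (extChartAt I' z₀).source :=
    ((isOpen_extChartAt_source p).eventually_mem (mem_extChartAt_source p)).and
      (hf.continuousAt.eventually ((isOpen_extChartAt_source z₀).eventually_mem hfp'))
  have heq : (extChartAt I' (f p) ∘ (extChartAt I' z₀).symm) ∘
        (extChartAt I' z₀ ∘ f ∘ (extChartAt I x₀).symm) =ᶠ[𝓝 (extChartAt I x₀ p)]
      (extChartAt I' (f p) ∘ f ∘ (extChartAt I p).symm) ∘
        (extChartAt I p ∘ (extChartAt I x₀).symm) := by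
    rw [← hinv] at hM
    filter_upwards [hcont.eventually hM] with y hy
    rw [hinv] at hy
    simp only [Function.comp_apply, (extChartAt I p).left_inv hy.1,
      (extChartAt I' z₀).left_inv hy.2]
  have key := k1.unique (k2.congr_of_eventuallyEq heq)
  have hm : mfderiv I I' f p =
      fderiv ℝ (extChartAt I' (f p) ∘ f ∘ (extChartAt I p).symm) (extChartAt I p p) := by
    rw [hf.mfderiv, I.range_eq_univ, fderivWithin_univ]
    rfl
  rw [e2, ← hm] at key
  have := congrArg (fun L : E →L[ℝ] E' ↦ L v) key
  refine Eq.trans ?_ (this.symm.trans ?_)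
  · rw [frame_eq_tangentCoordChange hp]
    rfl
  · rw [frame_eq_tangentCoordChange hfp]
    rfl

theorem formInChart_symm {h : Π x : M, TangentSpace I x →L[ℝ] TangentSpace I x →L[ℝ] ℝ}
    (hh : ∀ x v w, h x v w = h x w v) (x₀ : M) (y v w : E) :
    formInChart I h x₀ y v w = formInChart I h x₀ y w v := hh _ _ _

/-- Non-degeneracy gives injectivity into the dual, which has the same finite dimension. Thus
`inverse` in `christoffel` is a genuine inverse. -/
theorem isInvertible_formInChart_self [FiniteDimensional ℝ E]
    {h : Π x : M, TangentSpace I x →L[ℝ] TangentSpace I x →L[ℝ] ℝ}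
    (hh : IsNondegenerate I h) (x : M) :
    (formInChart I h x (extChartAt I x x)).IsInvertible := by
  set L := formInChart I h x (extChartAt I x x) with hL
  have hinj : Function.Injective L := by
    refine (injective_iff_map_eq_zero _).2 fun v hv ↦ hh x v fun w ↦ ?_
    rw [← formInChart_self h x v w, ← hL, hv]
    rfl
  have hdim : Module.finrank ℝ E = Module.finrank ℝ (E →L[ℝ] ℝ) := by
    rw [← LinearMap.toContinuousLinearMap.finrank_eq (R := ℝ) (M := E →ₗ[ℝ] ℝ)]
    exact (Subspace.dual_finrank_eq).symm
  exact ⟨(LinearEquiv.ofInjectiveOfFinrankEq L.toLinearMap hinj hdim).toContinuousLinearEquiv,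
    by ext; rfl⟩

theorem formInChart_christoffel [FiniteDimensional ℝ E]
    {h : Π x : M, TangentSpace I x →L[ℝ] TangentSpace I x →L[ℝ] ℝ}
    (hh : IsNondegenerate I h) (x : M) (v w z : E) :
    2 * formInChart I h x (extChartAt I x x) (christoffel I h x (extChartAt I x x) v w) z =
      fderiv ℝ (formInChart I h x) (extChartAt I x x) v w z +
      fderiv ℝ (formInChart I h x) (extChartAt I x x) w v z -
      fderiv ℝ (formInChart I h x) (extChartAt I x x) z v w := by
  rw [christoffel, (isInvertible_formInChart_self hh x).self_apply_inverse]
  simp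

/-- Uniqueness in Koszul's formula: Christoffel symbols can be identified by checking a candidate,
without inverting the metric. -/
theorem eq_christoffel [FiniteDimensional ℝ E]
    {h : Π x : M, TangentSpace I x →L[ℝ] TangentSpace I x →L[ℝ] ℝ}
    (hh : IsNondegenerate I h) (x : M) {v w c : E}
    (hc : ∀ z, 2 * formInChart I h x (extChartAt I x x) c z =
      fderiv ℝ (formInChart I h x) (extChartAt I x x) v w z +
      fderiv ℝ (formInChart I h x) (extChartAt I x x) w v z -
      fderiv ℝ (formInChart I h x) (extChartAt I x x) z v w) :
    c = christoffel I h x (extChartAt I x x) v w := by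
  obtain ⟨e, he⟩ := isInvertible_formInChart_self hh x
  apply e.injective
  ext z
  have h1 := formInChart_christoffel hh x v w z
  rw [← hc z, ← he] at h1
  simpa using h1.symm

theorem christoffel_add_smul
    (h : Π x : M, TangentSpace I x →L[ℝ] TangentSpace I x →L[ℝ] ℝ) (x : M) (y v w z : E) (t : ℝ) :
    christoffel I h x y (v + t • w) z = christoffel I h x y v z + t • christoffel I h x y w z := by
  simp only [christoffel]
  rw [← map_smul, ← map_add]
  congr 1
  ext a
  simp
  ring

theorem christoffel_comm [I.Boundaryless] [FiniteDimensional ℝ E]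
    {h : Π x : M, TangentSpace I x →L[ℝ] TangentSpace I x →L[ℝ] ℝ}
    (hh : IsSmoothSymmetricForm I h) (x : M) (v w : E) :
    christoffel I h x (extChartAt I x x) v w = christoffel I h x (extChartAt I x x) w v := by
  have hd : DifferentiableAt ℝ (formInChart I h x) (extChartAt I x x) :=
    (contDiffAt_formInChart hh x).differentiableAt (by simp)
  have hs (a : E) : fderiv ℝ (formInChart I h x) (extChartAt I x x) a v w =
      fderiv ℝ (formInChart I h x) (extChartAt I x x) a w v := by
    have h1 := fderiv_form_apply hd (differentiableAt_const v) (differentiableAt_const w) a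
    have h2 := fderiv_form_apply hd (differentiableAt_const w) (differentiableAt_const v) a
    simp only [formInChart_symm hh.symm x _ v w] at h1
    simp only [fderiv_fun_const, map_zero, zero_apply, add_zero, Pi.zero_apply] at h1 h2
    rw [← h1, h2]
  simp only [christoffel]
  congr 2
  ext a
  simp only [sub_apply, add_apply, ContinuousLinearMap.flip_apply, hs]
  ring

end Charts

/-! ### Induced charts of TM and the differential of a parallel field. -/

section TangentBundle

variable {E : Type*} [NormedAddCommGroup E] [NormedSpace ℝ E]
  {H : Type*} [TopologicalSpace H] {I : ModelWithCorners ℝ E H}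
  {M : Type*} [TopologicalSpace M] [ChartedSpace H M] [IsManifold I ∞ M]

theorem extChartAt_tangent_apply (z₀ z : TangentBundle I M) :
    extChartAt I.tangent z₀ z = (extChartAt I z₀.proj z.proj,
      (trivializationAt E (TangentSpace I : M → Type _) z₀.proj z).2) :=
  rfl

theorem extChartAt_tangent_section (u : Π x : M, TangentSpace I x) {x₀ : M} {y : E}
    (hy : y ∈ (extChartAt I x₀).target) (w : TangentSpace I x₀) :
    extChartAt I.tangent (⟨x₀, w⟩ : TangentBundle I M)
      (⟨(extChartAt I x₀).symm y, u ((extChartAt I x₀).symm y)⟩ : TangentBundle I M) =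
      (y, fieldInChart I u x₀ y) := by
  rw [extChartAt_tangent_apply]
  exact Prod.ext ((extChartAt I x₀).right_inv hy) rfl

theorem trivializationAt_frame {x₀ p : M} (hp : p ∈ (chartAt H x₀).source) (W : E) :
    (trivializationAt E (TangentSpace I : M → Type _) x₀
      (⟨p, frame I x₀ p W⟩ : TangentBundle I M)).2 = W := by
  have h := (trivializationAt E (TangentSpace I : M → Type _) x₀).continuousLinearMapAt_symmL
    (R := ℝ) (b := p) hp W
  rwa [Bundle.Trivialization.continuousLinearMapAt_apply_of_mem _ _ hp] at h

theorem trivializationAt_self_snd (z : TangentBundle I M) :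
    (trivializationAt E (TangentSpace I : M → Type _) z.proj z).2 = z.2 := by
  have h := trivializationAt_frame (I := I) (mem_chart_source H z.proj) (z.2 : E)
  rwa [show frame I z.proj z.proj (z.2 : E) = z.2 from frame_self z.proj _] at h

theorem extChartAt_tangent_fiber (x : M) (v w : TangentSpace I x) :
    extChartAt I.tangent (⟨x, v⟩ : TangentBundle I M) (⟨x, w⟩ : TangentBundle I M) =
      (extChartAt I x x, (w : E)) := by
  rw [extChartAt_tangent_apply]
  exact Prod.ext rfl (trivializationAt_self_snd ⟨x, w⟩)

theorem frame_tangent_fiber (x : M) (v w : TangentSpace I x) (a : E × E) :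
    frame I.tangent (⟨x, v⟩ : TangentBundle I M) (⟨x, w⟩ : TangentBundle I M) a = a :=
  frame_self (I := I.tangent) (⟨x, w⟩ : TangentBundle I M) a

/-- The coordinate change between induced charts of the tangent bundle preserves vertical
vectors. -/
theorem frame_tangent_vertical [I.Boundaryless] {z₀ z : TangentBundle I M}
    (hz : z.proj ∈ (chartAt H z₀.proj).source) (Z : E) :
    frame I.tangent z₀ z (0, Z) = verticalLift I z (frame I z₀.proj z.proj Z) := by
  have hz' : z ∈ (chartAt (ModelProd H E) z₀).source :=
    (TangentBundle.mem_chart_source_iff z z₀).2 hz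
  have hD := hasFDerivWithinAt_tangentCoordChange (I := I.tangent) (x := z₀) (y := z) (z := z)
    ⟨by simpa using hz, mem_extChartAt_source z⟩
  rw [I.tangent.range_eq_univ, hasFDerivWithinAt_univ, extChartAt_tangent_apply] at hD
  -- Restrict the coordinate change to one fibre: there it is the linear map `tangentCoordChange`,
  -- which is its own derivative.
  have hin : HasFDerivAt (fun W : E ↦ (extChartAt I z₀.proj z.proj, W))
      ((0 : E →L[ℝ] E).prod (ContinuousLinearMap.id ℝ E))
      ((trivializationAt E (TangentSpace I : M → Type _) z₀.proj z).2) :=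
    (hasFDerivAt_const _ _).prodMk (hasFDerivAt_id _)
  have hcomp := HasFDerivAt.comp
    (g := extChartAt I.tangent z ∘ (extChartAt I.tangent z₀).symm) _ hD hin
  have heq : (extChartAt I.tangent z ∘ (extChartAt I.tangent z₀).symm) ∘
      (fun W : E ↦ (extChartAt I z₀.proj z.proj, W)) =
      fun W ↦ (extChartAt I z.proj z.proj, tangentCoordChange I z₀.proj z.proj z.proj W) := by
    funext W
    have h1 : extChartAt I.tangent z₀ ⟨z.proj, frame I z₀.proj z.proj W⟩ =
        (extChartAt I z₀.proj z.proj, W) := by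
      rw [extChartAt_tangent_apply]
      exact Prod.ext rfl (trivializationAt_frame hz W)
    simp only [Function.comp_apply]
    rw [← h1, (extChartAt I.tangent z₀).left_inv (by simpa using hz)]
    rw [frame_eq_tangentCoordChange hz]
    exact extChartAt_tangent_fiber z.proj z.2 _
  rw [heq] at hcomp
  have hout : HasFDerivAt
      (fun W ↦ (extChartAt I z.proj z.proj, tangentCoordChange I z₀.proj z.proj z.proj W))
      ((0 : E →L[ℝ] E).prod (tangentCoordChange I z₀.proj z.proj z.proj))
      ((trivializationAt E (TangentSpace I : M → Type _) z₀.proj z).2) :=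
    (hasFDerivAt_const _ _).prodMk (ContinuousLinearMap.hasFDerivAt _)
  have key := congrArg (fun L : E →L[ℝ] E × E ↦ L Z) (hcomp.unique hout)
  rw [frame_eq_tangentCoordChange hz', frame_eq_tangentCoordChange hz]
  exact key

theorem mfderiv_section_frame [I.Boundaryless] {u : Π x : M, TangentSpace I x} {x₀ : M}
    (hu : IsSmoothField I u) {p : M} (hp : p ∈ (chartAt H x₀).source) (w : TangentSpace I x₀)
    (v : E) :
    mfderiv I I.tangent (fun x ↦ (⟨x, u x⟩ : TangentBundle I M)) p (frame I x₀ p v) =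
      frame I.tangent (⟨x₀, w⟩ : TangentBundle I M) (⟨p, u p⟩ : TangentBundle I M)
        (fderiv ℝ (fun y ↦ (y, fieldInChart I u x₀ y)) (extChartAt I x₀ p) v) := by
  have hd := (hu p).mdifferentiableAt (by simp)
  rw [mfderiv_frame (z₀ := (⟨x₀, w⟩ : TangentBundle I M)) hd hp
    ((TangentBundle.mem_chart_source_iff _ _).2 hp)]
  congr 2
  refine Filter.EventuallyEq.fderiv_eq ?_
  filter_upwards [(isOpen_extChartAt_target x₀).mem_nhds
    ((extChartAt I x₀).map_source (by simpa using hp))] with y hy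
  exact extChartAt_tangent_section u hy w

/-- The symmetry of Γ puts ∇u = 0 in the argument order Γ(u, X) used by `horizontalLift`. -/
theorem fderiv_fieldInChart_self [I.Boundaryless] [FiniteDimensional ℝ E]
    {h : Π x : M, TangentSpace I x →L[ℝ] TangentSpace I x →L[ℝ] ℝ}
    (hh : IsSmoothSymmetricForm I h) {u : Π x : M, TangentSpace I x} (hu : IsParallel I h u)
    (x : M) (X : E) :
    fderiv ℝ (fieldInChart I u x) (extChartAt I x x) X =
      - christoffel I h x (extChartAt I x x) (fieldInChart I u x (extChartAt I x x)) X := by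
  rw [christoffel_comm hh]
  exact eq_neg_of_add_eq_zero_left ((congrArg (fun w : E ↦
    fderiv ℝ (fieldInChart I u x) (extChartAt I x x) X + christoffel I h x (extChartAt I x x) X w)
    (fieldInChart_self u x)).trans (hu.2 x X))

/-- The differential of a parallel vector field, as a map into the tangent bundle, is the
horizontal lift. -/
theorem mfderiv_parallel_section [I.Boundaryless] [FiniteDimensional ℝ E]
    {h : Π x : M, TangentSpace I x →L[ℝ] TangentSpace I x →L[ℝ] ℝ}
    (hh : IsSmoothSymmetricForm I h) {u : Π x : M, TangentSpace I x} (hu : IsParallel I h u)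
    (x : M) (X : TangentSpace I x) :
    mfderiv I I.tangent (fun x ↦ (⟨x, u x⟩ : TangentBundle I M)) x X =
      horizontalLift I h (⟨x, u x⟩ : TangentBundle I M) X := by
  have hud : DifferentiableAt ℝ (fieldInChart I u x) (extChartAt I x x) :=
    (contDiffAt_fieldInChart (hu.1 x)).differentiableAt (by simp)
  have h1 := mfderiv_section_frame hu.1 (mem_chart_source H x) (u x) (X : E)
  rw [show frame I x x (X : E) = X from frame_self x _] at h1
  rw [h1]
  refine (frame_self (I := I.tangent) (⟨x, u x⟩ : TangentBundle I M) _).trans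
    ((fderiv_graph_apply hud (X : E)).trans (Prod.ext rfl ?_))
  refine (fderiv_fieldInChart_self hh hu x (X : E)).trans ?_
  exact congrArg (fun w : E ↦ - christoffel I h x (extChartAt I x x) w (X : E))
    (fieldInChart_self u x)

/-- The squared norm of a parallel vector field is locally constant. -/
theorem eventually_norm_parallel_eq [I.Boundaryless] [FiniteDimensional ℝ E]
    {h : Π x : M, TangentSpace I x →L[ℝ] TangentSpace I x →L[ℝ] ℝ}
    (hh : IsSmoothSymmetricForm I h) (hnd : IsNondegenerate I h)
    {u : Π x : M, TangentSpace I x} (hu : IsParallel I h u) (x₀ : M) :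
    ∀ᶠ p in 𝓝 x₀, h p (u p) (u p) = h x₀ (u x₀) (u x₀) := by
  set ρ : M → ℝ := fun p ↦ h p (u p) (u p) with hρ
  have hchart (x p : M) (hp : p ∈ (chartAt H x).source) :
      formInChart I h x (extChartAt I x p) (fieldInChart I u x (extChartAt I x p))
        (fieldInChart I u x (extChartAt I x p)) = ρ p := by
    rw [formInChart_extChartAt h hp, frame_fieldInChart u hp]
  -- The covariant derivative at x is defined in the chart around x, so d|u|² = 0 is checked at each
  -- point in its own chart.
  have hder (x : M) : HasMFDerivAt I 𝓘(ℝ, ℝ) ρ x 0 := by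
    have hf : DifferentiableAt ℝ (formInChart I h x) (extChartAt I x x) :=
      (contDiffAt_formInChart hh x).differentiableAt (by simp)
    have hud : DifferentiableAt ℝ (fieldInChart I u x) (extChartAt I x x) :=
      (contDiffAt_fieldInChart (hu.1 x)).differentiableAt (by simp)
    set r : E → ℝ := fun y ↦ formInChart I h x y (fieldInChart I u x y) (fieldInChart I u x y)
      with hr
    have hrd : DifferentiableAt ℝ r (extChartAt I x x) := (hf.clm_apply hud).clm_apply hud
    have hr0 : HasFDerivAt r (0 : E →L[ℝ] ℝ) (extChartAt I x x) := by
      convert hrd.hasFDerivAt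
      ext X
      rw [hr, fderiv_form_apply hf hud hud, fderiv_fieldInChart_self hh hu,
        christoffel_comm hh]
      have k1 := formInChart_christoffel hnd x X (fieldInChart I u x (extChartAt I x x))
        (fieldInChart I u x (extChartAt I x x))
      rw [formInChart_symm hh.symm x _ (fieldInChart I u x (extChartAt I x x))]
      simp only [map_neg, neg_apply, zero_apply]
      linarith
    have heq : ρ =ᶠ[𝓝 x] r ∘ extChartAt I x := by
      filter_upwards [(chartAt H x).open_source.mem_nhds (mem_chart_source H x)] with p hp
      exact (hchart x p hp).symm
    have := hr0.hasMFDerivAt.comp x (mdifferentiableAt_extChartAt (I := I)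
      (mem_chart_source H x)).hasMFDerivAt
    exact (this.congr_of_eventuallyEq heq).congr_mfderiv (by ext; rfl)
  -- A single chart now suffices: a function with zero derivative on a ball is constant.
  have hcont : ∀ᶠ y in 𝓝 (extChartAt I x₀ x₀), ρ ((extChartAt I x₀).symm y) = ρ x₀ := by
    obtain ⟨ε, hε, hball⟩ := Metric.mem_nhds_iff.1 (extChartAt_target_mem_nhds (I := I) x₀)
    have hd : ∀ y ∈ Metric.ball (extChartAt I x₀ x₀) ε,
        HasFDerivAt (ρ ∘ (extChartAt I x₀).symm) (0 : E →L[ℝ] ℝ) y := by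
      intro y hy
      have h1 := mdifferentiableWithinAt_extChartAt_symm (I := I) (hball hy)
      rw [I.range_eq_univ, mdifferentiableWithinAt_univ] at h1
      refine HasMFDerivAt.hasFDerivAt ?_
      exact ((hder _).comp y h1.hasMFDerivAt).congr_mfderiv (by ext; rfl)
    filter_upwards [Metric.ball_mem_nhds _ hε] with y hy
    have h2 := Metric.isOpen_ball.is_const_of_fderiv_eq_zero (𝕜 := ℝ)
      (convex_ball (extChartAt I x₀ x₀) ε).isPreconnected
      (fun y hy ↦ (hd y hy).differentiableAt.differentiableWithinAt)
      (fun y hy ↦ (hd y hy).fderiv) hy (Metric.mem_ball_self hε)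
    simpa using h2
  filter_upwards [(continuousAt_extChartAt (I := I) x₀).eventually hcont,
    (chartAt H x₀).open_source.mem_nhds (mem_chart_source H x₀)] with p hp hps
  rwa [(extChartAt I x₀).left_inv (by simpa using hps)] at hp

end TangentBundle

/-! ### Differentiating fields tangent to a graph. -/

section Graph

variable {E : Type*} [NormedAddCommGroup E] [NormedSpace ℝ E]

/-- The derivative, along the graph of `u`, of a vector field tangent to that graph. -/
theorem exists_fderiv_tangent_graph {K : E × E → E × E} {u : E → E} {y₀ : E}
    (hK : DifferentiableAt ℝ K (y₀, u y₀)) (hu : ContDiffAt ℝ ∞ u y₀)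
    (ht : ∀ᶠ y in 𝓝 y₀, (K (y, u y)).2 = fderiv ℝ u y (K (y, u y)).1) (v : E) :
    ∃ W, fderiv ℝ K (y₀, u y₀) (v, fderiv ℝ u y₀ v) =
      (W, fderiv ℝ u y₀ W) + (0, fderiv ℝ (fderiv ℝ u) y₀ v (K (y₀, u y₀)).1) := by
  have hud : DifferentiableAt ℝ u y₀ := hu.differentiableAt (by simp)
  have hud2 : DifferentiableAt ℝ (fderiv ℝ u) y₀ :=
    (hu.fderiv_right (m := 1) (by norm_cast)).differentiableAt (by simp)
  have hgr : DifferentiableAt ℝ (fun y ↦ (y, u y)) y₀ := differentiableAt_id.prodMk hud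
  have hKgr : HasFDerivAt (fun y ↦ K (y, u y))
      ((fderiv ℝ K (y₀, u y₀)).comp (fderiv ℝ (fun y ↦ (y, u y)) y₀)) y₀ :=
    HasFDerivAt.comp (g := K) y₀ hK.hasFDerivAt hgr.hasFDerivAt
  have hK1 : HasFDerivAt (fun y ↦ (K (y, u y)).1) _ y₀ := hKgr.fst
  -- Tangency replaces K along the graph by (k, Du k). The product rule on Du k yields the tangent
  -- vector S_W plus the D²u term.
  have h2 := (hK1.prodMk (hud2.hasFDerivAt.clm_apply hK1)).congr_of_eventuallyEq
    (f₁ := fun y ↦ K (y, u y)) (ht.mono fun y hy ↦ Prod.ext rfl hy)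
  have h3 := congrArg (fun L : E →L[ℝ] E × E ↦ L v) (hKgr.unique h2)
  simp only [ContinuousLinearMap.comp_apply, fderiv_graph_apply hud] at h3
  refine ⟨(fderiv ℝ K (y₀, u y₀) (v, fderiv ℝ u y₀ v)).1, ?_⟩
  rw [h3]
  simp [fderiv_graph_apply hud]

end Graph

theorem eqOn_Ici_of_hasDerivWithinAt_zero {A : ℝ → ℝ}
    (hA : ∀ t ∈ Ici (0 : ℝ), HasDerivWithinAt A 0 (Ici 0) t) {t : ℝ} (ht : 0 ≤ t) : A t = A 0 := by
  refine (convex_Ici (0 : ℝ)).is_const_of_fderivWithin_eq_zero (𝕜 := ℝ)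
    (fun s hs ↦ (hA s hs).differentiableWithinAt) (fun s hs ↦ ?_) ht self_mem_Ici
  rw [(hA s hs).hasFDerivWithinAt.fderivWithin (uniqueDiffOn_Ici 0 s hs)]
  ext
  simp

/-! ### The image u(M) inside (TM, G). -/

section Section

variable {E : Type*} [NormedAddCommGroup E] [NormedSpace ℝ E]
  {H : Type*} [TopologicalSpace H] {I : ModelWithCorners ℝ E H}
  {M : Type*} [TopologicalSpace M] [ChartedSpace H M] [IsManifold I ∞ M]

theorem extChartAt_tangent_parallel (u : Π x : M, TangentSpace I x) {x₀ p : M}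
    (hp : p ∈ (chartAt H x₀).source) :
    extChartAt I.tangent (⟨x₀, u x₀⟩ : TangentBundle I M) (⟨p, u p⟩ : TangentBundle I M) =
      (extChartAt I x₀ p, fieldInChart I u x₀ (extChartAt I x₀ p)) := by
  have hp' : p ∈ (extChartAt I x₀).source := by simpa using hp
  have h := extChartAt_tangent_section u ((extChartAt I x₀).map_source hp') (u x₀)
  rwa [(extChartAt I x₀).left_inv hp'] at h

theorem formInChart_tangent_section
    (G : Π z : TangentBundle I M, TangentSpace I.tangent z →L[ℝ] TangentSpace I.tangent z →L[ℝ] ℝ)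
    (u : Π x : M, TangentSpace I x) {x₀ p : M} (hp : p ∈ (chartAt H x₀).source) (a b : E × E) :
    formInChart I.tangent G (⟨x₀, u x₀⟩ : TangentBundle I M)
        (extChartAt I x₀ p, fieldInChart I u x₀ (extChartAt I x₀ p)) a b =
      G ⟨p, u p⟩ (frame I.tangent (⟨x₀, u x₀⟩ : TangentBundle I M) ⟨p, u p⟩ a)
        (frame I.tangent (⟨x₀, u x₀⟩ : TangentBundle I M) ⟨p, u p⟩ b) := by
  rw [← extChartAt_tangent_parallel u hp]
  exact formInChart_extChartAt G ((TangentBundle.mem_chart_source_iff _ _).2 hp) a b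

theorem formInChart_tangent_fiber
    (G : Π z : TangentBundle I M, TangentSpace I.tangent z →L[ℝ] TangentSpace I.tangent z →L[ℝ] ℝ)
    (x : M) (v w : TangentSpace I x) (a b : E × E) :
    formInChart I.tangent G (⟨x, v⟩ : TangentBundle I M) (extChartAt I x x, (w : E)) a b =
      G ⟨x, w⟩ (a : TangentSpace I.tangent (⟨x, w⟩ : TangentBundle I M))
        (b : TangentSpace I.tangent (⟨x, w⟩ : TangentBundle I M)) := by
  have h := formInChart_extChartAt (x₀ := (⟨x, v⟩ : TangentBundle I M)) (p := ⟨x, w⟩) G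
    ((TangentBundle.mem_chart_source_iff _ _).2 (mem_chart_source H x)) a b
  rw [extChartAt_tangent_fiber] at h
  refine h.trans ?_
  have ha := frame_tangent_fiber x v w a
  have hb := frame_tangent_fiber x v w b
  rw [ha, hb]

theorem isSmoothSymmetricForm_inner
    (g : Bundle.ContMDiffRiemannianMetric I ∞ E (fun x : M ↦ TangentSpace I x)) :
    IsSmoothSymmetricForm I g.inner :=
  ⟨g.symm, g.contMDiff⟩

theorem isNondegenerate_inner
    (g : Bundle.ContMDiffRiemannianMetric I ∞ E (fun x : M ↦ TangentSpace I x)) :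
    IsNondegenerate I g.inner := by
  intro x v hv
  by_contra hne
  exact (g.pos x v hne).ne' (hv v)

variable [I.Boundaryless]

/-- A vector field on the tangent bundle that is tangent to the image of `u`, in coordinates. -/
theorem fieldInChart_tangent_section {u : Π x : M, TangentSpace I x} (hu : IsSmoothField I u)
    {Y : Π z : TangentBundle I M, TangentSpace I.tangent z} {x₀ p : M}
    (hp : p ∈ (chartAt H x₀).source)
    (hd : DifferentiableAt ℝ (fieldInChart I u x₀) (extChartAt I x₀ p))
    (hY : Y ⟨p, u p⟩ ∈
      range (mfderiv I I.tangent (fun x ↦ (⟨x, u x⟩ : TangentBundle I M)) p)) :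
    ∃ X, fieldInChart I.tangent Y (⟨x₀, u x₀⟩ : TangentBundle I M)
        (extChartAt I x₀ p, fieldInChart I u x₀ (extChartAt I x₀ p)) =
      (X, fderiv ℝ (fieldInChart I u x₀) (extChartAt I x₀ p) X) := by
  obtain ⟨V, hV⟩ := hY
  have hV' := (trivializationAt E (TangentSpace I : M → Type _) x₀).symmL_continuousLinearMapAt
    (R := ℝ) (b := p) hp V
  have hpz : (⟨p, u p⟩ : TangentBundle I M) ∈
      (chartAt (ModelProd H E) (⟨x₀, u x₀⟩ : TangentBundle I M)).source :=
    (TangentBundle.mem_chart_source_iff _ _).2 hp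
  refine ⟨(trivializationAt E (TangentSpace I : M → Type _) x₀).continuousLinearMapAt ℝ p V,
    frame_injective (I := I.tangent) hpz ?_⟩
  rw [← extChartAt_tangent_parallel u hp, frame_fieldInChart Y hpz, ← hV,
    ← fderiv_graph_apply hd, ← mfderiv_section_frame hu hp (u x₀)]
  exact congrArg _ hV'.symm

theorem mfderiv_section_apply {u : Π x : M, TangentSpace I x} (hu : IsSmoothField I u)
    (x : M) (v : E) :
    mfderiv I I.tangent (fun x ↦ (⟨x, u x⟩ : TangentBundle I M)) x (v : TangentSpace I x) =
      ((v, fderiv ℝ (fieldInChart I u x) (extChartAt I x x) v) : E × E) := by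
  have hud : DifferentiableAt ℝ (fieldInChart I u x) (extChartAt I x x) :=
    (contDiffAt_fieldInChart (hu x)).differentiableAt (by simp)
  have h1 := mfderiv_section_frame hu (mem_chart_source H x) (u x) v
  rw [show frame I x x v = v from frame_self x v] at h1
  rw [h1, fderiv_graph_apply hud]
  exact frame_self (I := I.tangent) (⟨x, u x⟩ : TangentBundle I M) _

variable [FiniteDimensional ℝ E]

/-- Both sides are the differential of the section `u` at p. This gives the horizontal lifts at
nearby points in the chart around x₀ without the transformation law of the Christoffel symbols. -/
theorem frame_tangent_horizontal {h : Π x : M, TangentSpace I x →L[ℝ] TangentSpace I x →L[ℝ] ℝ}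
    (hh : IsSmoothSymmetricForm I h) {u : Π x : M, TangentSpace I x} (hu : IsParallel I h u)
    {x₀ p : M} (hp : p ∈ (chartAt H x₀).source)
    (hd : DifferentiableAt ℝ (fieldInChart I u x₀) (extChartAt I x₀ p)) (X : E) :
    frame I.tangent (⟨x₀, u x₀⟩ : TangentBundle I M) (⟨p, u p⟩ : TangentBundle I M)
        (X, fderiv ℝ (fieldInChart I u x₀) (extChartAt I x₀ p) X) =
      horizontalLift I h (⟨p, u p⟩ : TangentBundle I M) (frame I x₀ p X) := by
  rw [← mfderiv_parallel_section hh hu, mfderiv_section_frame hu.1 hp (u x₀),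
    fderiv_graph_apply hd]

/-- The Christoffel symbols of `G` on vectors tangent to the image of a parallel vector field. -/
theorem christoffel_tangent_parallel
    (g : Bundle.ContMDiffRiemannianMetric I ∞ E (fun x : M ↦ TangentSpace I x))
    {u : Π x : M, TangentSpace I x} (hu : IsParallel I g.inner u) {a₁ a₂ a₃ b₁ b₂ b₃ : ℝ → ℝ}
    {G : Π z : TangentBundle I M,
      TangentSpace I.tangent z →L[ℝ] TangentSpace I.tangent z →L[ℝ] ℝ}
    (hG : IsSmoothSymmetricForm I.tangent G) (hGnat : IsGNatural I g a₁ a₂ a₃ b₁ b₂ b₃ G)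
    (hGnd : IsNondegenerate I.tangent G)
    (hA : ∀ t ∈ Ici (0 : ℝ), HasDerivWithinAt (a₁ + a₃) 0 (Ici 0) t)
    (hB : ∀ t ∈ Ici (0 : ℝ), (b₁ + b₃) t = 0) (x : M) (X Y : E) :
    christoffel I.tangent G (⟨x, u x⟩ : TangentBundle I M)
        (extChartAt I.tangent (⟨x, u x⟩ : TangentBundle I M) ⟨x, u x⟩)
        (X, fderiv ℝ (fieldInChart I u x) (extChartAt I x x) X)
        (Y, fderiv ℝ (fieldInChart I u x) (extChartAt I x x) Y) =
      (christoffel I g.inner x (extChartAt I x x) X Y,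
        fderiv ℝ (fieldInChart I u x) (extChartAt I x x)
          (christoffel I g.inner x (extChartAt I x x) X Y)) -
        (0, fderiv ℝ (fderiv ℝ (fieldInChart I u x)) (extChartAt I x x) X Y) := by
  have hg := isSmoothSymmetricForm_inner g
  have hgnd := isNondegenerate_inner g
  have hnn (p : M) (v : TangentSpace I p) : 0 ≤ g.inner p v v := by
    by_cases hv : v = 0
    · simp [hv]
    · exact (g.pos p v hv).le
  have hhor (p : M) (w X Y : TangentSpace I p) :
      G ⟨p, w⟩ (horizontalLift I g.inner ⟨p, w⟩ X) (horizontalLift I g.inner ⟨p, w⟩ Y) =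
        (a₁ + a₃) 0 * g.inner p X Y := by
    rw [hGnat.hor_hor, hB _ (hnn p w), eqOn_Ici_of_hasDerivWithinAt_zero hA (hnn p w)]
    ring
  have hpt := extChartAt_tangent_parallel u (mem_chart_source H x)
  have hu2 := contDiffAt_fieldInChart (hu.1 x)
  -- Koszul's formula needs the values of G in a neighbourhood along the graph. The last clause,
  -- constancy of |u|², freezes a₂ and b₂ there.
  have hnear : ∀ᶠ y in 𝓝 (extChartAt I x x), ∃ p ∈ (chartAt H x).source, extChartAt I x p = y ∧
      DifferentiableAt ℝ (fieldInChart I u x) (extChartAt I x p) ∧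
      g.inner p (u p) (u p) = g.inner x (u x) (u x) := by
    have h1 := (hu2.of_le (m := 1) (by simp)).eventually (by simp)
    have h2 := continuousAt_extChartAt_symm (I := I) x
    rw [ContinuousAt, extChartAt_to_inv] at h2
    filter_upwards [h1, h2.eventually (eventually_norm_parallel_eq hg hgnd hu x),
      extChartAt_target_mem_nhds (I := I) x] with y hy1 hy2 hy3
    have hr := (extChartAt I x).right_inv hy3
    refine ⟨(extChartAt I x).symm y, by simpa using (extChartAt I x).map_target hy3, hr, ?_, hy2⟩
    rw [hr]
    exact hy1.differentiableAt (by simp)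
  refine (eq_christoffel hGnd _ fun Z ↦ ?_).symm
  have hF := (contDiffAt_formInChart hG (⟨x, u x⟩ : TangentBundle I M)).differentiableAt (by simp)
  rw [hpt] at hF ⊢
  refine koszul_graph (f := formInChart I g.inner x)
    (F := formInChart I.tangent G (⟨x, u x⟩ : TangentBundle I M)) (u := fieldInChart I u x)
    (Γ := christoffel I g.inner x (extChartAt I x x)) (c := (a₁ + a₃) 0)
    (α := a₂ (g.inner x (u x) (u x))) (β := b₂ (g.inner x (u x) (u x)))
    ((contDiffAt_formInChart hg x).differentiableAt (by simp)) hF hu2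
    (Eventually.of_forall (formInChart_symm hg.symm x))
    (formInChart_symm hG.symm _ _) (formInChart_christoffel hgnd x)
    (christoffel_comm hg x) (christoffel_add_smul g.inner x _)
    (fderiv_fieldInChart_self hg hu x) ?_ ?_ ?_ X Y Z
  · filter_upwards [hnear] with y ⟨p, hp, hpy, hd, _⟩ X Y
    subst hpy
    rw [formInChart_tangent_section G u hp, frame_tangent_horizontal hg hu hp hd,
      frame_tangent_horizontal hg hu hp hd, hhor, formInChart_extChartAt _ hp]
  · filter_upwards [hnear] with y ⟨p, hp, hpy, hd, hρ⟩ X Z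
    subst hpy
    rw [formInChart_tangent_section G u hp, frame_tangent_horizontal hg hu hp hd,
      frame_tangent_vertical hp, hGnat.hor_ver, formInChart_extChartAt _ hp,
      formInChart_extChartAt _ hp, formInChart_extChartAt _ hp, frame_fieldInChart u hp, hρ]
  -- Over x itself the induced chart gives (X, -Γ(w, X)) as the horizontal lift at every w in the
  -- fibre, so A = c and B = 0 apply away from u(x).
  · intro w X Y
    exact (formInChart_tangent_fiber G x (u x) w _ _).trans ((hhor x w X Y).trans
      (congrArg _ (formInChart_self g.inner x X Y).symm))

/-- The image of a parallel vector field is totally geodesic. No assumption on `a₂` or on the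
curvature is needed: `R(X, Y)u = 0` holds for a parallel field `u`, so the curvature terms
`R(u, X)Y` vanish along its image. -/
theorem isTotallyGeodesic_parallel
    (g : Bundle.ContMDiffRiemannianMetric I ∞ E (fun x : M ↦ TangentSpace I x))
    {u : Π x : M, TangentSpace I x} (hu : IsParallel I g.inner u) {a₁ a₂ a₃ b₁ b₂ b₃ : ℝ → ℝ}
    {G : Π z : TangentBundle I M,
      TangentSpace I.tangent z →L[ℝ] TangentSpace I.tangent z →L[ℝ] ℝ}
    (hG : IsSmoothSymmetricForm I.tangent G) (hGnat : IsGNatural I g a₁ a₂ a₃ b₁ b₂ b₃ G)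
    (hGnd : IsNondegenerate I.tangent G)
    (hA : ∀ t ∈ Ici (0 : ℝ), HasDerivWithinAt (a₁ + a₃) 0 (Ici 0) t)
    (hB : ∀ t ∈ Ici (0 : ℝ), (b₁ + b₃) t = 0) :
    IsTotallyGeodesic I I.tangent G (fun x ↦ (⟨x, u x⟩ : TangentBundle I M)) where
  contMDiff := hu.1
  injective_mfderiv x v w hvw := by
    have h1 := (mfderiv_section_apply hu.1 x (v : E)).symm.trans
      (hvw.trans (mfderiv_section_apply hu.1 x (w : E)))
    exact congrArg Prod.fst (show ((_, _) : E × E) = (_, _) from h1)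
  -- The bundle projection is a continuous left inverse.
  isEmbedding := IsEmbedding.of_leftInverse (f := Bundle.TotalSpace.proj) (fun _ ↦ rfl)
    (FiberBundle.continuous_proj E (TangentSpace I : M → Type _)) hu.1.continuous
  covDeriv_mem Y x hY htan v := by
    have hpt := extChartAt_tangent_parallel u (mem_chart_source H x)
    have hu2 := contDiffAt_fieldInChart (hu.1 x)
    have hYd := (contDiffAt_fieldInChart hY).differentiableAt (by simp)
    have hY0 := fieldInChart_self (I := I.tangent) Y (⟨x, u x⟩ : TangentBundle I M)
    rw [hpt] at hYd hY0
    have hnear : ∀ᶠ y in 𝓝 (extChartAt I x x), ∃ X,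
        fieldInChart I.tangent Y (⟨x, u x⟩ : TangentBundle I M) (y, fieldInChart I u x y) =
          (X, fderiv ℝ (fieldInChart I u x) y X) := by
      have h1 := (hu2.of_le (m := 1) (by simp)).eventually (by simp)
      have h2 := continuousAt_extChartAt_symm (I := I) x
      rw [ContinuousAt, extChartAt_to_inv] at h2
      filter_upwards [h1, h2.eventually htan, extChartAt_target_mem_nhds (I := I) x]
        with y hy1 hy2 hy3
      have hr := (extChartAt I x).right_inv hy3
      have hp : (extChartAt I x).symm y ∈ (chartAt H x).source := by
        simpa using (extChartAt I x).map_target hy3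
      have hd := hy1.differentiableAt (by simp)
      rw [← hr] at hd
      have := fieldInChart_tangent_section hu.1 hp hd hy2
      rwa [hr] at this
    obtain ⟨Y₀, hY₀⟩ := hnear.self_of_nhds
    obtain ⟨W, hW⟩ := exists_fderiv_tangent_graph hYd hu2
      (hnear.mono fun y ⟨X, hX⟩ ↦ by rw [hX]) (v : E)
    rw [hY₀] at hW
    -- Here W is the first component of the coordinate derivative of Y along the graph. Adding Γ(v,
    -- Y₀) gives the g-covariant derivative of the base component of Y, whose image under du is the
    -- claimed value.
    refine ⟨(W + christoffel I g.inner x (extChartAt I x x) (v : E) Y₀ : E), ?_⟩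
    rw [mfderiv_section_apply hu.1]
    have hΓ := christoffel_tangent_parallel g hu hG hGnat hGnd hA hB x (v : E) Y₀
    have hYz : (Y ⟨x, u x⟩ : E × E) =
        (Y₀, fderiv ℝ (fieldInChart I u x) (extChartAt I x x) Y₀) := hY0.symm.trans hY₀
    have hv := mfderiv_section_apply hu.1 x (v : E)
    have hcov (a b : E × E)
        (ha : (mfderiv I I.tangent (fun x ↦ (⟨x, u x⟩ : TangentBundle I M)) x v : E × E) = a)
        (hb : (Y ⟨x, u x⟩ : E × E) = b) :
        covDeriv I.tangent G Y ⟨x, u x⟩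
          (mfderiv I I.tangent (fun x ↦ (⟨x, u x⟩ : TangentBundle I M)) x v) =
        (fderiv ℝ (fieldInChart I.tangent Y (⟨x, u x⟩ : TangentBundle I M))
          (extChartAt I.tangent (⟨x, u x⟩ : TangentBundle I M) ⟨x, u x⟩) a +
        christoffel I.tangent G (⟨x, u x⟩ : TangentBundle I M)
          (extChartAt I.tangent (⟨x, u x⟩ : TangentBundle I M) ⟨x, u x⟩) a b : E × E) := by
      subst ha hb
      rfl
    refine Eq.trans ?_ (hcov _ _ hv hYz).symm
    rw [hΓ, hpt, hW]
    -- D stands for D²u(v, Y₀), which occurs with opposite signs in the derivative of Y and in Γ^G.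
    have halg (L : E →L[ℝ] E) (C D : E) :
        ((W + C, L (W + C)) : E × E) = ((W, L W) + (0, D)) + ((C, L C) - (0, D)) := by
      simp
    exact halg _ _ _

end Section

end GNatural

theorem mainTheorem2 {E : Type*} [NormedAddCommGroup E] [NormedSpace ℝ E] [FiniteDimensional ℝ E]
    {M : Type*} [TopologicalSpace M] [T2Space M] [ChartedSpace E M] [IsManifold 𝓘(ℝ, E) ∞ M]
    (g : Bundle.ContMDiffRiemannianMetric 𝓘(ℝ, E) ∞ E (fun x : M ↦ TangentSpace 𝓘(ℝ, E) x))
    (u : Π x : M, TangentSpace 𝓘(ℝ, E) x) (hu : GNatural.IsParallel 𝓘(ℝ, E) g.inner u)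
    (a₁ a₂ a₃ b₁ b₂ b₃ : ℝ → ℝ)
    (G : Π z : TangentBundle 𝓘(ℝ, E) M,
      TangentSpace 𝓘(ℝ, E).tangent z →L[ℝ] TangentSpace 𝓘(ℝ, E).tangent z →L[ℝ] ℝ)
    (hG : GNatural.IsSmoothSymmetricForm 𝓘(ℝ, E).tangent G)
    (hGnat : GNatural.IsGNatural 𝓘(ℝ, E) g a₁ a₂ a₃ b₁ b₂ b₃ G)
    (hGnd : GNatural.IsNondegenerate 𝓘(ℝ, E).tangent G)
    (hA : ∀ t ∈ Set.Ici (0 : ℝ), HasDerivWithinAt (a₁ + a₃) 0 (Set.Ici 0) t)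
    (hB : ∀ t ∈ Set.Ici (0 : ℝ), (b₁ + b₃) t = 0)
    (hflat : (∀ t ∈ Set.Ici (0 : ℝ), a₂ t = 0) ∨ GNatural.IsFlat 𝓘(ℝ, E) g.inner) :
    GNatural.IsTotallyGeodesic 𝓘(ℝ, E) 𝓘(ℝ, E).tangent G
      (fun x : M ↦ (⟨x, u x⟩ : TangentBundle 𝓘(ℝ, E) M)) := by
  exact GNatural.isTotallyGeodesic_parallel g hu hG hGnat hGnd hA hB
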